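/- Let $n\ge 2$, let $x\in\mathbb{R}^n$ and $r>0$, and let $B^n(x,r)=\{y\in\mathbb{R}^n:|y-x|<r\}$. A function $u$ on a proper subdomain $G\subsetneq\mathbb{R}^n$ (a nonempty connected open set) is said to satisfy the $(s,C(s))$-Harnack inequality in $G$, where $s\in(0,1)$ and $C(s)\ge 1$, if $u$ is continuous and nonnegative on $G$ and $$\max_{\overline{B}^n(y,s\rho)} u\;\le\; C(s)\,\min_{\overline{B}^n(y,s\rho)} u$$ for all $y\in\mathbb{R}^n$ and $\rho>0$ with $B^n(y,\rho)\subset G$. It is called an $(s,C(s))$-Harnack function in $G$ if this holds for every $s\in(0,1)$. Every positive harmonic function $u:B^n(x,r)\to(0,\infty)$ (that is, $u$ is twice continuously differentiable with $\sum_{i=1}^n\partial^2u/\partial x_i^2=0$) is an $(s,C(s))$-Harnack function in $B^n(x,r)$ with $$C(s)=C(s,n)=\frac{1}{1-s^2}\left(\frac{1+s}{1-s}\right)^n,\qquad s\in(0,1).$$ -/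

import Mathlib

/-- A proper subdomain of `ℝⁿ`: a nonempty, connected, open set different from `ℝⁿ`. -/
def IsProperSubdomain {n : ℕ} (G : Set (EuclideanSpace ℝ (Fin n))) : Prop :=
  IsOpen G ∧ IsConnected G ∧ G ≠ Set.univ

/-- `u` satisfies the `(s, C)`-Harnack inequality in `G`: here `G` is a proper subdomain of `ℝⁿ`,
`u` is continuous and nonnegative on `G`, `s ∈ (0,1)`, `C ≥ 1`, and
`max_B u ≤ C * min_B u` for the closed ball `B` of centre `y` and radius `s * ρ`
whenever the open ball of centre `y` and radius `ρ > 0` is contained in `G`.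
The maximum and the minimum are attained values of `u` on `B`.
The values of `u` outside `G` play no role. -/
structure SatisfiesHarnack {n : ℕ} (G : Set (EuclideanSpace ℝ (Fin n))) (s C : ℝ)
    (u : EuclideanSpace ℝ (Fin n) → ℝ) : Prop where
  domain : IsProperSubdomain G
  continuousOn : ContinuousOn u G
  nonneg : ∀ y ∈ G, 0 ≤ u y
  s_mem : s ∈ Set.Ioo (0 : ℝ) 1
  one_le : 1 ≤ C
  max_le_mul_min : ∀ (y : EuclideanSpace ℝ (Fin n)) (ρ : ℝ), 0 < ρ → Metric.ball y ρ ⊆ G →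
    ∃ M m : ℝ, IsGreatest (u '' Metric.closedBall y (s * ρ)) M ∧
      IsLeast (u '' Metric.closedBall y (s * ρ)) m ∧ M ≤ C * m

/-- `u` is an `(s, C(s))`-Harnack function in `G`: it satisfies the `(s, C(s))`-Harnack
inequality in `G` for every `s ∈ (0,1)`. -/
def IsHarnackFunction {n : ℕ} (G : Set (EuclideanSpace ℝ (Fin n))) (C : ℝ → ℝ)
    (u : EuclideanSpace ℝ (Fin n) → ℝ) : Prop :=
  ∀ s ∈ Set.Ioo (0 : ℝ) 1, SatisfiesHarnack G s (C s) u

/-! In the unit ball, Poisson's formula would give the bounds at once: `u z` is an average of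
boundary values against a kernel pinched between constants. Here spheres are replaced by radial
weights `q`, so only volume integrals occur.

If `q x • x` is the gradient of a compactly supported `Q`, Green's identity shows that `∫ u(s x)
v(x) q(x) = ∫ u(x) v(s x) q(x)` for harmonic `u`, `v` and `0 < s ≤ 1` (`integral_dilation_swap`).
Taking `v = 1` and letting `s → 0` gives the mean value property.

Take for `v` the Poisson kernel with pole `e = z / ‖z‖`, take `s = ‖z‖`, and let `q` concentrate
near the unit sphere. The left side, over `∫ q`, tends to `u z`. On the right the dilated kernel
lies between `(1 - s²) / (1 + s)ⁿ` and `1 / (1 - s)ⁿ` whenever `‖z‖ ≤ s < 1`, and `∫ u q = u 0 ∫ q`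
(`harnack_bounds`). The ratio of these two constants is `C(s)`; translation and scaling give all
balls. -/

open MeasureTheory InnerProductSpace Laplacian Metric Filter Topology

/-! ### Green's identity, dilations and the mean value property -/

section HarmonicIdentities

variable {E : Type*} [NormedAddCommGroup E] [InnerProductSpace ℝ E] [FiniteDimensional ℝ E]

theorem laplacian_eq_sum_fderiv_fderiv {ι : Type*} [Fintype ι] (b : OrthonormalBasis ι ℝ E)
    (f : E → ℝ) (x : E) :
    Δ f x = ∑ i, fderiv ℝ (fderiv ℝ f) x (b i) (b i) := by
  rw [laplacian_eq_iteratedFDeriv_orthonormalBasis f b]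
  simp [iteratedFDeriv_two_apply]

omit [FiniteDimensional ℝ E] in
theorem fderiv_comp_const_add_smul (f : E → ℝ) (c : E) (a : ℝ) :
    fderiv ℝ (fun x => f (c + a • x)) = fun x => a • fderiv ℝ f (c + a • x) := by
  ext1 x
  have h := fderiv_comp_smul (𝕜 := ℝ) (f := fun y => f (c + y)) a (x := x)
  simp only [fderiv_comp_add_left] at h
  exact h

theorem laplacian_comp_const_add_smul (f : E → ℝ) (c : E) (a : ℝ) (x : E) :
    Δ (fun x => f (c + a • x)) x = a ^ 2 * Δ f (c + a • x) := by
  have b := stdOrthonormalBasis ℝ E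
  have h : fderiv ℝ (fun x => a • fderiv ℝ f (c + a • x)) x
      = a • a • fderiv ℝ (fderiv ℝ f) (c + a • x) := by
    have h1 := fderiv_comp_smul (𝕜 := ℝ) (f := fun y => fderiv ℝ f (c + y)) a (x := x)
    simp only [fderiv_comp_add_left] at h1
    rw [← h1]
    exact congrFun (fderiv_const_smul_field (𝕜 := ℝ) (f := fun x => fderiv ℝ f (c + a • x)) a) x
  rw [laplacian_eq_sum_fderiv_fderiv b, laplacian_eq_sum_fderiv_fderiv b,
    fderiv_comp_const_add_smul, h, Finset.mul_sum]
  refine Finset.sum_congr rfl fun i _ => ?_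
  simp only [FunLike.coe_smul, Pi.smul_apply, smul_eq_mul]
  ring

theorem InnerProductSpace.HarmonicOnNhd.comp_const_add_smul {f : E → ℝ} {s t : Set E} (hf : HarmonicOnNhd f s)
    (c : E) (a : ℝ) (h : ∀ x ∈ t, c + a • x ∈ s) :
    HarmonicOnNhd (fun x => f (c + a • x)) t := by
  intro x hx
  obtain ⟨h1, h2⟩ := hf _ (h x hx)
  have hc : Continuous fun x : E => c + a • x := by fun_prop
  refine ⟨h1.comp x (f := fun x : E => c + a • x) (by fun_prop), ?_⟩
  filter_upwards [hc.continuousAt.eventually h2] with y hy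
  rw [laplacian_comp_const_add_smul, hy]
  simp

variable [MeasurableSpace E] [BorelSpace E]

/-- Green's second identity with a compactly supported weight. -/
theorem integral_fderiv_weight_wronskian_eq_zero {ι : Type*} [Fintype ι]
    (b : OrthonormalBasis ι ℝ E) {f g Q : E → ℝ}
    (hf : ContDiff ℝ 2 f) (hg : ContDiff ℝ 2 g) (hQ : ContDiff ℝ 1 Q) (hQc : HasCompactSupport Q)
    (hΔf : ∀ x, Q x ≠ 0 → Δ f x = 0) (hΔg : ∀ x, Q x ≠ 0 → Δ g x = 0) :
    ∫ x, ∑ i, (fderiv ℝ f x (b i) * g x - f x * fderiv ℝ g x (b i)) * fderiv ℝ Q x (b i) = 0 := by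
  have hf1 : ContDiff ℝ 1 (fderiv ℝ f) := hf.fderiv_right (by norm_num)
  have hg1 : ContDiff ℝ 1 (fderiv ℝ g) := hg.fderiv_right (by norm_num)
  have hf' : ContDiff ℝ 1 f := hf.of_le (by norm_num)
  have hg' : ContDiff ℝ 1 g := hg.of_le (by norm_num)
  have hW (i : ι) : ContDiff ℝ 1 fun x => fderiv ℝ f x (b i) * g x - f x * fderiv ℝ g x (b i) := by
    fun_prop
  have hWd (i : ι) : Continuous (fun x => fderiv ℝ (fun x =>
      fderiv ℝ f x (b i) * g x - f x * fderiv ℝ g x (b i)) x (b i)) :=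
    ((hW i).continuous_fderiv (by norm_num)).clm_apply continuous_const
  have hQd (i : ι) : Continuous (fun x => fderiv ℝ Q x (b i)) :=
    (hQ.continuous_fderiv (by norm_num)).clm_apply continuous_const
  have hQdc (i : ι) : HasCompactSupport (fun x => fderiv ℝ Q x (b i)) :=
    hQc.fderiv_apply (𝕜 := ℝ) (b i)
  have hI1 (i : ι) : Integrable fun x =>
      (fderiv ℝ f x (b i) * g x - f x * fderiv ℝ g x (b i)) * fderiv ℝ Q x (b i) :=
    ((hW i).continuous.mul (hQd i)).integrable_of_hasCompactSupport (hQdc i).mul_left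
  have hI2 (i : ι) : Integrable fun x => fderiv ℝ (fun x =>
      fderiv ℝ f x (b i) * g x - f x * fderiv ℝ g x (b i)) x (b i) * Q x :=
    ((hWd i).mul hQ.continuous).integrable_of_hasCompactSupport hQc.mul_left
  -- Integration by parts in each direction; the sum over `i` becomes `-∫ (Δf * g - f * Δg) * Q`.
  have key (i : ι) := integral_mul_fderiv_eq_neg_fderiv_mul_of_integrable (hI2 i) (hI1 i)
    (((hW i).continuous.mul hQ.continuous).integrable_of_hasCompactSupport hQc.mul_left)
    (fun x _ => (hW i).differentiable (by norm_num) x)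
    (fun x _ => hQ.differentiable (by norm_num) x)
  rw [integral_finsetSum _ fun i _ => hI1 i, Finset.sum_congr rfl fun i _ => key i,
    Finset.sum_neg_distrib, ← integral_finsetSum _ fun i _ => hI2 i, neg_eq_zero]
  refine integral_eq_zero_of_ae (Eventually.of_forall fun x => ?_)
  have hd (i : ι) : fderiv ℝ (fun x =>
      fderiv ℝ f x (b i) * g x - f x * fderiv ℝ g x (b i)) x (b i)
      = fderiv ℝ (fderiv ℝ f) x (b i) (b i) * g x - f x * fderiv ℝ (fderiv ℝ g) x (b i) (b i) := by
    have h1 : HasFDerivAt (fun x => fderiv ℝ f x (b i)) _ x :=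
      ((hf1.differentiable (by norm_num) x).hasFDerivAt).clm_apply (hasFDerivAt_const (b i) x)
    have h2 : HasFDerivAt (fun x => fderiv ℝ g x (b i)) _ x :=
      ((hg1.differentiable (by norm_num) x).hasFDerivAt).clm_apply (hasFDerivAt_const (b i) x)
    have h3 := (hf'.differentiable (by norm_num) x).hasFDerivAt
    have h4 := (hg'.differentiable (by norm_num) x).hasFDerivAt
    rw [((h1.fun_mul h4).fun_sub (h3.fun_mul h2)).fderiv]
    simp
    ring
  by_cases hx : Q x = 0
  · simp [hx]
  · simp only [hd, ← Finset.sum_mul, Finset.sum_sub_distrib, ← Finset.mul_sum,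
      ← laplacian_eq_sum_fderiv_fderiv, hΔf x hx, hΔg x hx]
    simp

theorem hasDerivAt_integral_of_continuous_of_compact_support {F F' : ℝ → E → ℝ} {K : Set E}
    (hK : IsCompact K) (hF : Continuous F.uncurry) (hF' : Continuous F'.uncurry)
    (hF0 : ∀ τ, ∀ x ∉ K, F τ x = 0) (hF'0 : ∀ τ, ∀ x ∉ K, F' τ x = 0)
    (h : ∀ τ x, HasDerivAt (F · x) (F' τ x) τ) (τ : ℝ) :
    HasDerivAt (fun τ => ∫ x, F τ x) (∫ x, F' τ x) τ := by
  have hc (τ : ℝ) : Continuous (F τ) := hF.comp (by fun_prop : Continuous fun x => (τ, x))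
  have hc' (τ : ℝ) : Continuous (F' τ) := hF'.comp (by fun_prop : Continuous fun x => (τ, x))
  obtain ⟨M, hM⟩ := ((isCompact_closedBall τ 1).prod hK).exists_bound_of_continuousOn
    hF'.continuousOn
  refine (hasDerivAt_integral_of_dominated_loc_of_deriv_le (bound := K.indicator fun _ => M)
    (closedBall_mem_nhds τ one_pos) (Eventually.of_forall fun τ => (hc τ).aestronglyMeasurable)
    ((hc τ).integrable_of_hasCompactSupport (.intro hK (hF0 τ)))
    (hc' τ).aestronglyMeasurable (Eventually.of_forall fun x y hy => ?_) ?_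
    (Eventually.of_forall fun x y _ => h y x)).2
  · by_cases hx : x ∈ K
    · simpa [hx] using hM (y, x) ⟨hy, hx⟩
    · simp [hx, hF'0 y x hx]
  · exact (integrable_indicator_iff hK.measurableSet).2 (integrableOn_const hK.measure_ne_top)

/-- `q` is a continuous radial weight, vanishing where `r ≤ ‖x‖`, such that the vector field
`x ↦ q x • x` is the gradient of the function `Q`, which vanishes where `r ≤ ‖x‖`. -/
structure IsRadialWeight (r : ℝ) (Q q : E → ℝ) : Prop where
  contDiff : ContDiff ℝ 1 Q
  continuous : Continuous q
  fderiv_eq : ∀ x h, fderiv ℝ Q x h = q x * inner ℝ x h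
  potential_eq_zero : ∀ x, r ≤ ‖x‖ → Q x = 0
  weight_eq_zero : ∀ x, r ≤ ‖x‖ → q x = 0

omit [InnerProductSpace ℝ E] [FiniteDimensional ℝ E] [MeasurableSpace E] [BorelSpace E] in
theorem notMem_closedBall_zero_le {x : E} {r : ℝ} (hx : x ∉ closedBall (0 : E) r) : r ≤ ‖x‖ := by
  rw [mem_closedBall_zero_iff] at hx
  exact (not_le.1 hx).le

/-- Green's identity for the two dilates: since the gradient of `Q` is `q x • x`, only radial
derivatives survive. The bounds on `a` and `b` keep the dilated points in the ball where `u` and `v`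
are harmonic. -/
theorem integral_dilation_wronskian_eq_zero {u v Q q : E → ℝ} {r : ℝ} (hq : IsRadialWeight r Q q)
    (hu : ContDiff ℝ 2 u) (hv : ContDiff ℝ 2 v) (hΔu : ∀ x ∈ ball (0 : E) r, Δ u x = 0)
    (hΔv : ∀ x ∈ ball (0 : E) r, Δ v x = 0) {a b : ℝ} (ha : |a| ≤ 1) (hb : |b| ≤ 1) :
    ∫ x, (fderiv ℝ u (a • x) (a • x) * v (b • x) - u (a • x) * fderiv ℝ v (b • x) (b • x)) * q x
      = 0 := by
  have e := stdOrthonormalBasis ℝ E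
  have hsc {c : ℝ} (hc : |c| ≤ 1) {x : E} (hx : Q x ≠ 0) : (0 : E) + c • x ∈ ball (0 : E) r := by
    have h1 : ‖x‖ < r := by
      by_contra h
      exact hx (hq.potential_eq_zero x (not_lt.1 h))
    rw [zero_add, mem_ball_zero_iff, norm_smul, Real.norm_eq_abs]
    nlinarith [norm_nonneg x]
  have key := integral_fderiv_weight_wronskian_eq_zero e
    (f := fun x => u (0 + a • x)) (g := fun x => v (0 + b • x))
    (hu.comp (by fun_prop)) (hv.comp (by fun_prop)) hq.contDiff
    (.intro (isCompact_closedBall (0 : E) r) fun x hx =>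
      hq.potential_eq_zero x (notMem_closedBall_zero_le hx))
    (fun x hx => by rw [laplacian_comp_const_add_smul, hΔu _ (hsc ha hx), mul_zero])
    (fun x hx => by rw [laplacian_comp_const_add_smul, hΔv _ (hsc hb hx), mul_zero])
  rw [← key]
  refine integral_congr_ae (Eventually.of_forall fun x => ?_)
  have hx (L : E →L[ℝ] ℝ) : L x = ∑ i, L (e i) * inner ℝ x (e i) := by
    conv_lhs => rw [← e.sum_repr x]
    simp [e.repr_apply_apply, real_inner_comm, mul_comm]
  simp only [fderiv_comp_const_add_smul, hq.fderiv_eq]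
  simp only [zero_add, FunLike.coe_smul, Pi.smul_apply, smul_eq_mul, map_smul]
  rw [hx (fderiv ℝ u (a • x)), hx (fderiv ℝ v (b • x))]
  simp only [Finset.mul_sum, Finset.sum_mul, ← Finset.sum_sub_distrib]
  exact Finset.sum_congr rfl fun i _ => by ring

/-- The dilation is transferred gradually: the factors `exp τ` on `u` and `exp (σ - τ)` on `v` have
constant product `s`, and the `τ`-derivative of the integral is the vanishing Wronskian integral. -/
theorem integral_dilation_swap_of_contDiff {u v Q q : E → ℝ} {r : ℝ} (hq : IsRadialWeight r Q q)
    (hu : ContDiff ℝ 2 u) (hv : ContDiff ℝ 2 v) (hΔu : ∀ x ∈ ball (0 : E) r, Δ u x = 0)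
    (hΔv : ∀ x ∈ ball (0 : E) r, Δ v x = 0) {s : ℝ} (hs : 0 < s) (hs1 : s ≤ 1) :
    ∫ x, u (s • x) * v x * q x = ∫ x, u x * v (s • x) * q x := by
  set σ := Real.log s with hσ
  have hσ0 : σ ≤ 0 := Real.log_nonpos hs.le hs1
  have hes : Real.exp σ = s := Real.exp_log hs
  have hu' : Continuous (fderiv ℝ u) := hu.continuous_fderiv (by norm_num)
  have hv' : Continuous (fderiv ℝ v) := hv.continuous_fderiv (by norm_num)
  have huc := hu.continuous
  have hvc := hv.continuous
  have hqc := hq.continuous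
  have hder (τ : ℝ) := hasDerivAt_integral_of_continuous_of_compact_support
    (F := fun τ x => u (Real.exp τ • x) * v (Real.exp (σ - τ) • x) * q x)
    (F' := fun τ x => (fderiv ℝ u (Real.exp τ • x) (Real.exp τ • x) * v (Real.exp (σ - τ) • x)
      - u (Real.exp τ • x) * fderiv ℝ v (Real.exp (σ - τ) • x) (Real.exp (σ - τ) • x)) * q x)
    (isCompact_closedBall (0 : E) r) (by unfold Function.uncurry; fun_prop)
    (by unfold Function.uncurry; fun_prop)
    (fun τ x hx => by rw [hq.weight_eq_zero x (notMem_closedBall_zero_le hx), mul_zero])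
    (fun τ x hx => by rw [hq.weight_eq_zero x (notMem_closedBall_zero_le hx), mul_zero])
    (fun τ x => by
      have h1 : HasDerivAt (fun τ => Real.exp τ • x) (Real.exp τ • x) τ :=
        (Real.hasDerivAt_exp τ).smul_const x
      have h2 : HasDerivAt (fun τ => Real.exp (σ - τ) • x) (-(Real.exp (σ - τ) • x)) τ := by
        have h := (((hasDerivAt_id τ).const_sub σ).exp).smul_const x
        simpa using h
      have h3 := (hu.differentiable (by norm_num) (Real.exp τ • x)).hasFDerivAt.comp_hasDerivAt τ h1
      have h4 := (hv.differentiable (by norm_num)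
        (Real.exp (σ - τ) • x)).hasFDerivAt.comp_hasDerivAt τ h2
      refine ((h3.mul h4).mul_const (q x)).congr_deriv ?_
      simp only [Function.comp_apply, map_neg]
      ring) τ
  -- On `[σ, 0]` both factors are at most `1`; the endpoints `τ = σ` and `τ = 0` give the two sides.
  have hconst := constant_of_has_deriv_right_zero (a := σ) (b := 0)
    (fun τ _ => (hder τ).continuousAt.continuousWithinAt)
    (fun τ hτ => by
      have h := (hder τ).hasDerivWithinAt (s := Set.Ici τ)
      rwa [integral_dilation_wronskian_eq_zero hq hu hv hΔu hΔv
        (by rw [abs_of_pos (Real.exp_pos _)]; exact Real.exp_le_one_iff.2 hτ.2.le)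
        (by rw [abs_of_pos (Real.exp_pos _)]; exact Real.exp_le_one_iff.2 (by linarith [hτ.1]))]
        at h)
    0 ⟨hσ0, le_rfl⟩
  simp only [Real.exp_zero, one_smul, sub_zero, sub_self, hes] at hconst
  exact hconst.symm

omit [MeasurableSpace E] [BorelSpace E] in
-- A cutoff supplies the global smoothness required by Green's identity, without changing `u` where
-- the weights live.
theorem InnerProductSpace.HarmonicOnNhd.exists_contDiff_eqOn_ball {u : E → ℝ} (hu : HarmonicOnNhd u (ball 0 1))
    {r : ℝ} (hr0 : 0 < r) (hr : r < 1) :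
    ∃ w : E → ℝ, ContDiff ℝ 2 w ∧ Set.EqOn w u (ball 0 r) ∧ ∀ x ∈ ball (0 : E) r, Δ w x = 0 := by
  let χ : ContDiffBump (0 : E) := ⟨r, (r + 1) / 2, hr0, by linarith⟩
  have heq : Set.EqOn (fun x => χ x * u x) u (ball 0 r) := fun x hx => by
    simp [χ.one_of_mem_closedBall (ball_subset_closedBall hx)]
  refine ⟨fun x => χ x * u x, ?_, heq, fun x hx => ?_⟩
  · rw [contDiff_iff_contDiffAt]
    intro x
    by_cases hx : x ∈ ball (0 : E) 1
    · exact χ.contDiff.contDiffAt.mul (hu x hx).1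
    · have hx' : x ∈ (closedBall (0 : E) ((r + 1) / 2))ᶜ := by
        simp only [mem_ball_zero_iff, not_lt, Set.mem_compl_iff, mem_closedBall_zero_iff,
          not_le] at hx ⊢
        linarith
      refine (contDiffAt_const (c := (0 : ℝ))).congr_of_eventuallyEq ?_
      filter_upwards [isClosed_closedBall.isOpen_compl.mem_nhds hx'] with y hy
      rw [χ.zero_of_le_dist, zero_mul]
      simp only [Set.mem_compl_iff, mem_closedBall, not_le] at hy
      exact hy.le
  · rw [(laplacian_congr_nhds (heq.eventuallyEq_of_mem (isOpen_ball.mem_nhds hx))).eq_of_nhds]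
    exact (hu x (ball_subset_ball hr.le hx)).2.eq_of_nhds

/-- For functions `u`, `v` harmonic in the unit ball, dilations may be moved from `u` to `v` in
integrals against a radial weight. -/
theorem InnerProductSpace.HarmonicOnNhd.integral_dilation_swap {u v Q q : E → ℝ} {r : ℝ} (hr0 : 0 < r) (hr : r < 1)
    (hq : IsRadialWeight r Q q) (hu : HarmonicOnNhd u (ball 0 1))
    (hv : HarmonicOnNhd v (ball 0 1)) {s : ℝ} (hs : 0 < s) (hs1 : s ≤ 1) :
    ∫ x, u (s • x) * v x * q x = ∫ x, u x * v (s • x) * q x := by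
  obtain ⟨u', hu1, hu2, hu3⟩ := hu.exists_contDiff_eqOn_ball hr0 hr
  obtain ⟨v', hv1, hv2, hv3⟩ := hv.exists_contDiff_eqOn_ball hr0 hr
  have key := integral_dilation_swap_of_contDiff hq hu1 hv1 hu3 hv3 hs hs1
  have hsm {x : E} (hx : x ∈ ball (0 : E) r) : s • x ∈ ball (0 : E) r := by
    rw [mem_ball_zero_iff] at hx ⊢
    rw [norm_smul, Real.norm_of_nonneg hs.le]
    nlinarith [norm_nonneg x]
  convert key using 3 with x x
  all_goals
    by_cases hx : x ∈ ball (0 : E) r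
    · simp only [hu2 hx, hv2 hx, hu2 (hsm hx), hv2 (hsm hx)]
    · rw [hq.weight_eq_zero x (by simpa using hx), mul_zero, mul_zero]

/-- The mean value property of harmonic functions, for radial weights. -/
theorem InnerProductSpace.HarmonicOnNhd.integral_mul_radialWeight {u Q q : E → ℝ} {r : ℝ} (hr0 : 0 < r) (hr : r < 1)
    (hq : IsRadialWeight r Q q) (hu : HarmonicOnNhd u (ball 0 1)) :
    ∫ x, u x * q x = u 0 * ∫ x, q x := by
  obtain ⟨w, hw1, hw2, hw3⟩ := hu.exists_contDiff_eqOn_ball hr0 hr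
  have hwc := hw1.continuous
  have hqc := hq.continuous
  have hJ : Continuous fun s : ℝ => ∫ x, w (s • x) * q x := by
    rw [← continuousOn_univ]
    refine continuousOn_integral_of_compact_support (isCompact_closedBall (0 : E) r)
      (by unfold Function.uncurry; fun_prop) fun p x _ hx => ?_
    rw [hq.weight_eq_zero x (notMem_closedBall_zero_le hx), mul_zero]
  have h0 : Tendsto (fun s : ℝ => ∫ x, w (s • x) * q x) (𝓝[>] 0) (𝓝 (∫ x, w 0 * q x)) := by
    simpa using (hJ.tendsto 0).mono_left nhdsWithin_le_nhds
  have h1 : Tendsto (fun s : ℝ => ∫ x, w (s • x) * q x) (𝓝[>] 0) (𝓝 (∫ x, w x * q x)) := by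
    refine tendsto_const_nhds.congr' ?_
    filter_upwards [Ioc_mem_nhdsGT (zero_lt_one' ℝ)] with s hs
    -- Swapping against the constant `1` shows that the integral does not depend on `s`.
    have h := integral_dilation_swap_of_contDiff hq hw1 (contDiff_const (c := (1 : ℝ))) hw3
      (fun x _ => by simp) hs.1 hs.2
    simpa using h.symm
  have h2 : ∫ x, u x * q x = ∫ x, w x * q x := by
    refine integral_congr_ae (Eventually.of_forall fun x => ?_)
    by_cases hx : x ∈ ball (0 : E) r
    · simp only [hw2 hx]
    · simp only [hq.weight_eq_zero x (by simpa using hx), mul_zero]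
  rw [h2, tendsto_nhds_unique h1 h0, integral_const_mul, hw2 (mem_ball_self hr0)]

end HarmonicIdentities

/-! ### The Poisson kernel and radial weights near the sphere -/

section PoissonKernel

variable {E : Type*} [NormedAddCommGroup E] [InnerProductSpace ℝ E] [FiniteDimensional ℝ E]

omit [FiniteDimensional ℝ E] in
-- Reduces the diagonal Hessian entries to one-variable calculus along a line.
theorem fderiv_fderiv_apply_apply_of_hasDerivAt {f : E → ℝ} {x h : E}
    (hf : ContDiffAt ℝ 2 f x) {φ : ℝ → ℝ} {c : ℝ}
    (hφ : ∀ᶠ τ in 𝓝 (0 : ℝ), HasDerivAt (fun t : ℝ => f (x + t • h)) (φ τ) τ)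
    (hc : HasDerivAt φ c 0) : fderiv ℝ (fderiv ℝ f) x h h = c := by
  have hline (τ : ℝ) : HasDerivAt (fun t : ℝ => x + t • h) h τ := by
    simpa using ((hasDerivAt_id τ).smul_const h).const_add x
  have hcont : Tendsto (fun t : ℝ => x + t • h) (𝓝 0) (𝓝 x) := by
    simpa using (hline 0).continuousAt.tendsto
  have h1 : φ =ᶠ[𝓝 0] fun τ => fderiv ℝ f (x + τ • h) h := by
    filter_upwards [hφ, hcont.eventually (hf.eventually (by simp))] with τ h1 h2
    exact h1.unique
      ((h2.differentiableAt (by norm_num)).hasFDerivAt.comp_hasDerivAt τ (hline τ))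
  have h2 : DifferentiableAt ℝ (fderiv ℝ f) (x + (0 : ℝ) • h) := by
    rw [zero_smul, add_zero]
    exact (hf.fderiv_right (m := 1) (by norm_num)).differentiableAt (by norm_num)
  have h3 : HasDerivAt (fun τ : ℝ => fderiv ℝ f (x + τ • h))
      (fderiv ℝ (fderiv ℝ f) (x + (0 : ℝ) • h) h) 0 :=
    h2.hasFDerivAt.comp_hasDerivAt 0 (hline 0)
  have h4 := (h3.clm_apply (hasDerivAt_const 0 h)).congr_of_eventuallyEq h1
  rw [← h4.unique hc]
  simp

/-- The Poisson kernel of the unit ball with pole `e`, up to a constant factor. -/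
noncomputable def unitBallPoissonKernel (e x : E) : ℝ :=
  (1 - ‖x‖ ^ 2) / ‖x - e‖ ^ Module.finrank ℝ E

omit [FiniteDimensional ℝ E] in
theorem unitBallPoissonKernel_eq_rpow (e x : E) :
    unitBallPoissonKernel e x
      = (1 - ‖x‖ ^ 2) * (‖x - e‖ ^ 2) ^ (-(Module.finrank ℝ E : ℝ) / 2) := by
  rw [unitBallPoissonKernel, div_eq_mul_inv, ← Real.rpow_natCast ‖x - e‖ 2,
    ← Real.rpow_natCast ‖x - e‖ (Module.finrank ℝ E),
    ← Real.rpow_mul (norm_nonneg _), ← Real.rpow_neg (norm_nonneg _)]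
  congr 2
  push_cast
  ring

theorem harmonicOnNhd_unitBallPoissonKernel {e : E} (he : ‖e‖ = 1) :
    HarmonicOnNhd (unitBallPoissonKernel e) (ball 0 1) := by
  have hpos {x : E} (hx : x ∈ ball (0 : E) 1) : 0 < ‖x - e‖ := by
    rw [norm_pos_iff, sub_ne_zero]
    rintro rfl
    simp [he] at hx
  set p : ℝ := -(Module.finrank ℝ E : ℝ) / 2 with hp
  have hv : unitBallPoissonKernel e = fun x : E => (1 - ‖x‖ ^ 2) * (‖x - e‖ ^ 2) ^ p :=
    funext (unitBallPoissonKernel_eq_rpow e)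
  have hcd {x : E} (hx : x ∈ ball (0 : E) 1) : ContDiffAt ℝ 2 (unitBallPoissonKernel e) x := by
    rw [hv]
    refine ContDiffAt.mul (contDiffAt_const.sub (contDiffAt_id.norm_sq ℝ)) ?_
    exact ((contDiffAt_id.sub contDiffAt_const).norm_sq ℝ).rpow_const_of_ne
      (pow_ne_zero 2 (hpos hx).ne')
  refine fun x hx => ⟨hcd hx, ?_⟩
  filter_upwards [isOpen_ball.mem_nhds hx] with x hx
  have b := stdOrthonormalBasis ℝ E
  have hD : 0 < ‖x - e‖ ^ 2 := pow_pos (hpos hx) 2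
  have hsecond (h : E) : fderiv ℝ (fderiv ℝ (unitBallPoissonKernel e)) x h h
      = -2 * ‖h‖ ^ 2 * (‖x - e‖ ^ 2) ^ p
        - 8 * p * (‖x - e‖ ^ 2) ^ (p - 1) * (inner ℝ x h * inner ℝ (x - e) h)
        + (1 - ‖x‖ ^ 2) * p * (4 * (p - 1) * (‖x - e‖ ^ 2) ^ (p - 2) * inner ℝ (x - e) h ^ 2
          + 2 * (‖x - e‖ ^ 2) ^ (p - 1) * ‖h‖ ^ 2) := by
    -- Along a line, the numerator and the squared distance to the pole are quadratic polynomials in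
    -- `t`.
    have hquad (y : E) (t : ℝ) :
        ‖y + t • h‖ ^ 2 = ‖y‖ ^ 2 + 2 * inner ℝ y h * t + ‖h‖ ^ 2 * t ^ 2 := by
      rw [norm_add_sq_real, inner_smul_right, norm_smul, mul_pow, Real.norm_eq_abs, sq_abs]
      ring
    have hquad' (A B C t : ℝ) : HasDerivAt (fun t => A + B * t + C * t ^ 2) (B + 2 * C * t) t := by
      refine ((((hasDerivAt_id t).const_mul B).const_add A).add
        ((hasDerivAt_pow 2 t).const_mul C)).congr_deriv ?_
      simp
      ring
    set D : ℝ → ℝ := fun t => ‖x - e‖ ^ 2 + 2 * inner ℝ (x - e) h * t + ‖h‖ ^ 2 * t ^ 2 with hDdef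
    set D' : ℝ → ℝ := fun t => 2 * inner ℝ (x - e) h + 2 * ‖h‖ ^ 2 * t with hD'def
    set N : ℝ → ℝ := fun t => (1 - ‖x‖ ^ 2) + -(2 * inner ℝ x h) * t + -‖h‖ ^ 2 * t ^ 2 with hNdef
    set N' : ℝ → ℝ := fun t => -(2 * inner ℝ x h) + 2 * -‖h‖ ^ 2 * t with hN'def
    have hD1 (t : ℝ) : HasDerivAt D (D' t) t := hquad' _ _ _ t
    have hN1 (t : ℝ) : HasDerivAt N (N' t) t := hquad' _ _ _ t
    have hD2 : HasDerivAt D' (2 * ‖h‖ ^ 2) 0 := by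
      have h := ((hasDerivAt_id (0 : ℝ)).const_mul (2 * ‖h‖ ^ 2)).const_add
        (2 * inner ℝ (x - e) h)
      rwa [mul_one] at h
    have hN2 : HasDerivAt N' (2 * -‖h‖ ^ 2) 0 := by
      have h := ((hasDerivAt_id (0 : ℝ)).const_mul (2 * -‖h‖ ^ 2)).const_add
        (-(2 * inner ℝ x h))
      rwa [mul_one] at h
    have hD0 : D 0 = ‖x - e‖ ^ 2 := by simp [hDdef]
    have hline (t : ℝ) : unitBallPoissonKernel e (x + t • h) = N t * D t ^ p := by
      rw [hv]
      simp only [hDdef, hNdef, ← hquad]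
      rw [add_sub_right_comm, hquad x]
      ring_nf
    refine fderiv_fderiv_apply_apply_of_hasDerivAt (hcd hx)
      (φ := fun t => N' t * D t ^ p + N t * (D' t * p * D t ^ (p - 1))) ?_ ?_
    · have hev : ∀ᶠ t in 𝓝 (0 : ℝ), D t ≠ 0 :=
        (hD1 0).continuousAt.eventually_ne (by rw [hD0]; exact hD.ne')
      filter_upwards [hev] with t ht
      simp only [hline]
      exact (hN1 t).mul ((hD1 t).rpow_const (Or.inl ht))
    · have hne : D 0 ≠ 0 := by rw [hD0]; exact hD.ne'
      refine ((hN2.mul ((hD1 0).rpow_const (p := p) (Or.inl hne))).add ((hN1 0).mul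
        ((hD2.mul_const p).fun_mul ((hD1 0).rpow_const (p := p - 1) (Or.inl hne))))).congr_deriv ?_
      rw [hD0, show p - 1 - 1 = p - 2 by ring]
      simp only [hD'def, hNdef, hN'def]
      ring
  rw [laplacian_eq_sum_fderiv_fderiv b]
  have h1 (i) : ‖b i‖ = 1 := b.orthonormal.1 i
  have h2 : ∑ i, inner ℝ x (b i) * inner ℝ (x - e) (b i) = inner ℝ x (x - e) := by
    rw [← b.sum_inner_mul_inner x (x - e)]
    exact Finset.sum_congr rfl fun i _ => by rw [real_inner_comm (x - e)]
  have h3 : ∑ i, inner ℝ (x - e) (b i) ^ 2 = ‖x - e‖ ^ 2 := by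
    rw [← real_inner_self_eq_norm_sq, ← b.sum_inner_mul_inner (x - e) (x - e)]
    exact Finset.sum_congr rfl fun i _ => by rw [real_inner_comm (x - e), sq]
  simp only [hsecond, h1, Finset.sum_add_distrib, Finset.sum_sub_distrib, ← Finset.mul_sum,
    h2, h3, Finset.sum_const, Finset.card_univ, Fintype.card_fin, nsmul_eq_mul, Pi.zero_apply]
  have e1 : (‖x - e‖ ^ 2) ^ p = (‖x - e‖ ^ 2) ^ (p - 1) * ‖x - e‖ ^ 2 := by
    rw [← Real.rpow_add_one hD.ne']
    ring_nf
  have e2 : (‖x - e‖ ^ 2) ^ (p - 2) * ‖x - e‖ ^ 2 = (‖x - e‖ ^ 2) ^ (p - 1) := by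
    rw [← Real.rpow_add_one hD.ne']
    ring_nf
  -- Here `‖e‖ = 1` enters. Together with `n = -2p` in `e4`, it makes all terms cancel.
  have e3 : 2 * inner ℝ x (x - e) = ‖x‖ ^ 2 + ‖x - e‖ ^ 2 - 1 := by
    have h := norm_sub_sq_real x (x - e)
    rw [sub_sub_cancel, he] at h
    linarith
  have e4 : (Module.finrank ℝ E : ℝ) = -2 * p := by rw [hp]; ring
  rw [e1, e4]
  linear_combination (4 * p * (p - 1) * (1 - ‖x‖ ^ 2)) * e2
    - 4 * p * (‖x - e‖ ^ 2) ^ (p - 1) * e3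

variable (E) in
/-- There are nonnegative radial weights in the unit ball supported arbitrarily close to the unit
sphere. -/
theorem exists_isRadialWeight_shell [Nontrivial E] [MeasurableSpace E] [BorelSpace E] {a : ℝ}
    (ha0 : 0 < a) (ha : a < 1) :
    ∃ (r : ℝ) (Q q : E → ℝ), 0 < r ∧ r < 1 ∧ IsRadialWeight r Q q ∧ (∀ x, 0 ≤ q x) ∧
      (∀ x, ‖x‖ ≤ a → q x = 0) ∧ 0 < ∫ x, q x := by
  obtain ⟨r, har, hr⟩ := exists_between ha
  have hr0 : 0 < r := ha0.trans har
  have hlt : 0 < r ^ 2 - a ^ 2 := by nlinarith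
  set g : ℝ → ℝ := Real.smoothTransition with hg
  have hgc : ContDiff ℝ 2 g := Real.smoothTransition.contDiff (n := 2)
  have hgm : Monotone g := Real.smoothTransition.monotone
  have hgd : Continuous (deriv g) := hgc.continuous_deriv (by norm_num)
  have hg0 {y : ℝ} (hy : y ≤ 0) : deriv g y = 0 := by
    refine IsLocalMin.deriv_eq_zero (Eventually.of_forall fun z => ?_)
    rw [hg, Real.smoothTransition.zero_of_nonpos hy]
    exact Real.smoothTransition.nonneg z
  have hg1 {y : ℝ} (hy : 1 ≤ y) : deriv g y = 0 := by
    refine IsLocalMax.deriv_eq_zero (Eventually.of_forall fun z => ?_)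
    rw [hg, Real.smoothTransition.one_of_one_le hy]
    exact Real.smoothTransition.le_one z
  -- `A (‖x‖ ^ 2)` falls from `1` at `‖x‖ = a` to `0` at `‖x‖ = r`, and `deriv g` vanishes outside
  -- `(0, 1)`. Using `‖x‖ ^ 2` makes the potential smooth at the origin and its gradient a multiple
  -- of `x`.
  set A : ℝ → ℝ := fun y => (r ^ 2 - y) / (r ^ 2 - a ^ 2) with hA
  have hcont : Continuous fun x : E => 2 / (r ^ 2 - a ^ 2) * deriv g (A (‖x‖ ^ 2)) := by
    fun_prop
  have hnonneg (x : E) : 0 ≤ 2 / (r ^ 2 - a ^ 2) * deriv g (A (‖x‖ ^ 2)) :=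
    mul_nonneg (by positivity) hgm.deriv_nonneg
  have hout (x : E) (hx : r ≤ ‖x‖) : A (‖x‖ ^ 2) ≤ 0 :=
    div_nonpos_of_nonpos_of_nonneg (by nlinarith) hlt.le
  have hw : IsRadialWeight r (fun x : E => -g (A (‖x‖ ^ 2)))
      (fun x : E => 2 / (r ^ 2 - a ^ 2) * deriv g (A (‖x‖ ^ 2))) := by
    refine ⟨?_, hcont, fun x h => ?_, fun x hx => ?_, fun x hx => ?_⟩
    · have h1 : ContDiff ℝ 1 fun x : E => A (‖x‖ ^ 2) :=
        (contDiff_const.sub (contDiff_id.norm_sq ℝ)).div_const _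
      exact ((hgc.of_le (by norm_num)).comp h1).neg
    · have h1 : HasFDerivAt (fun x : E => ‖x‖ ^ 2) _ x := (hasStrictFDerivAt_norm_sq x).hasFDerivAt
      have h2 : HasDerivAt A (-1 / (r ^ 2 - a ^ 2)) (‖x‖ ^ 2) :=
        ((hasDerivAt_id _).const_sub _).div_const _
      have h3 := ((hgc.differentiable (by norm_num) (A (‖x‖ ^ 2))).hasDerivAt.comp _ h2)
      have h4 := (h3.comp_hasFDerivAt x h1).neg
      have h5 : fderiv ℝ (fun x : E => -g (A (‖x‖ ^ 2))) x = _ := h4.fderiv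
      rw [h5]
      simp
      ring
    · rw [hg, Real.smoothTransition.zero_of_nonpos (hout x hx), neg_zero]
    · rw [hg0 (hout x hx), mul_zero]
  refine ⟨r, _, _, hr0, hr, hw, hnonneg, fun x hx => ?_, ?_⟩
  · have h1 : 1 ≤ A (‖x‖ ^ 2) := by
      rw [hA, le_div_iff₀ hlt]
      nlinarith [norm_nonneg x]
    rw [hg1 h1, mul_zero]
  · obtain ⟨y, hy, hyd⟩ := exists_deriv_eq_slope g (zero_lt_one' ℝ) hgc.continuous.continuousOn
      (hgc.differentiable (by norm_num)).differentiableOn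
    obtain ⟨x, hx⟩ := exists_norm_eq E (Real.sqrt_nonneg (r ^ 2 - y * (r ^ 2 - a ^ 2)))
    have hxy : A (‖x‖ ^ 2) = y := by
      rw [hx, Real.sq_sqrt (by nlinarith [hy.1, hy.2]), hA]
      field_simp
      ring
    refine hcont.integral_pos_of_hasCompactSupport_nonneg_nonzero
      (.intro (isCompact_closedBall (0 : E) r) fun x hx =>
        hw.weight_eq_zero x (notMem_closedBall_zero_le hx)) hnonneg (x := x) ?_
    rw [hxy, hyd]
    simp only [hg, Real.smoothTransition.one, Real.smoothTransition.zero]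
    positivity

end PoissonKernel

/-! ### Approximation at the pole and Harnack bounds -/

section Harnack

variable {E : Type*} [NormedAddCommGroup E] [InnerProductSpace ℝ E] [FiniteDimensional ℝ E]

omit [FiniteDimensional ℝ E] in
theorem unitBallPoissonKernel_nonneg (e : E) {x : E} (hx : ‖x‖ ≤ 1) :
    0 ≤ unitBallPoissonKernel e x :=
  div_nonneg (by nlinarith [norm_nonneg x]) (by positivity)

omit [FiniteDimensional ℝ E] in
theorem unitBallPoissonKernel_le {e x : E} {a δ : ℝ} (ha0 : 0 ≤ a) (ha : a ≤ ‖x‖) (hx : ‖x‖ ≤ 1)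
    (hδ : 0 < δ) (hxe : δ ≤ ‖x - e‖) :
    unitBallPoissonKernel e x ≤ (1 - a ^ 2) / δ ^ Module.finrank ℝ E := by
  unfold unitBallPoissonKernel
  have h1 : 0 ≤ 1 - a ^ 2 := by nlinarith
  gcongr

omit [FiniteDimensional ℝ E] in
-- The numerator `1 - ‖t • x‖ ^ 2` and the distance to the pole are estimated separately. This is
-- not sharp, but yields exactly the required constant.
theorem unitBallPoissonKernel_smul_bounds {e x : E} {s t : ℝ} (he : ‖e‖ = 1) (hx : ‖x‖ ≤ 1)
    (ht : 0 ≤ t) (hts : t ≤ s) (hs : s < 1) :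
    (1 - s ^ 2) / (1 + s) ^ Module.finrank ℝ E ≤ unitBallPoissonKernel e (t • x) ∧
      unitBallPoissonKernel e (t • x) ≤ 1 / (1 - s) ^ Module.finrank ℝ E := by
  have hn : ‖t • x‖ ≤ s := by
    rw [norm_smul, Real.norm_of_nonneg ht]
    nlinarith [norm_nonneg x]
  have h1 : ‖t • x - e‖ ≤ 1 + s := (norm_sub_le _ _).trans (by linarith)
  have h2 : 1 - s ≤ ‖t • x - e‖ := by
    have h := norm_sub_norm_le e (t • x)
    rw [norm_sub_rev] at h
    linarith
  have h3 : 0 < 1 - s := by linarith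
  have h4 : 0 < ‖t • x - e‖ := h3.trans_le h2
  have h5 : ‖t • x‖ ^ 2 ≤ s ^ 2 := by gcongr
  have h6 : 0 ≤ 1 - ‖t • x‖ ^ 2 := by nlinarith [norm_nonneg (t • x)]
  have h7 : 1 - ‖t • x‖ ^ 2 ≤ 1 := by nlinarith [norm_nonneg (t • x)]
  unfold unitBallPoissonKernel
  constructor <;> gcongr

variable [MeasurableSpace E] [BorelSpace E]

theorem IsRadialWeight.integrable_mul {r : ℝ} {Q q F : E → ℝ} (hq : IsRadialWeight r Q q)
    (hr : r < 1) (hF : ContinuousOn F (ball 0 1)) : Integrable fun x => F x * q x := by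
  have h1 : IntegrableOn (fun x => F x * q x) (closedBall 0 r) :=
    ((hF.mono (closedBall_subset_ball hr)).mul
      hq.continuous.continuousOn).integrableOn_compact (isCompact_closedBall 0 r)
  refine (integrableOn_iff_integrable_of_support_subset fun x hx => ?_).1 h1
  by_contra h
  exact hx (by simp [hq.weight_eq_zero x (notMem_closedBall_zero_le h)])

/-- Integrals against the Poisson kernel and a radial weight concentrated near the unit sphere
approximate the value of the integrand at the pole. -/
theorem exists_isRadialWeight_abs_integral_poissonKernel_sub_le [Nontrivial E] {e : E}
    (he : ‖e‖ = 1) {f : E → ℝ} (hf : ContinuousOn f (closedBall 0 1)) {ε : ℝ} (hε : 0 < ε) :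
    ∃ (r : ℝ) (Q q : E → ℝ), 0 < r ∧ r < 1 ∧ IsRadialWeight r Q q ∧ (∀ x, 0 ≤ q x) ∧
      0 < ∫ x, q x ∧
      |(∫ x, f x * unitBallPoissonKernel e x * q x) - f e * ∫ x, q x| ≤ ε * ∫ x, q x := by
  have heb : e ∈ closedBall (0 : E) 1 := by simp [he]
  obtain ⟨M, hM⟩ := (isCompact_closedBall (0 : E) 1).exists_bound_of_continuousOn hf
  have hM0 : 0 ≤ M := (norm_nonneg _).trans (hM e heb)
  obtain ⟨δ, hδ, hfδ⟩ := Metric.continuousWithinAt_iff.1 (hf e heb) (ε / 2) (by positivity)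
  -- At distance at least `δ` from the pole the kernel on the shell is at most `(1 - a ^ 2) / δ ^
  -- n`, which tends to `0` as `a → 1`.
  obtain ⟨a, ⟨ha0, ha1⟩, ha⟩ : ∃ a ∈ Set.Ioo (0 : ℝ) 1,
      2 * M * ((1 - a ^ 2) / δ ^ Module.finrank ℝ E) < ε / 2 := by
    have hcont : Continuous fun a : ℝ => 2 * M * ((1 - a ^ 2) / δ ^ Module.finrank ℝ E) := by
      fun_prop
    have h1 : ∀ᶠ a in 𝓝[<] (1 : ℝ), 2 * M * ((1 - a ^ 2) / δ ^ Module.finrank ℝ E) < ε / 2 := by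
      refine (hcont.tendsto 1).mono_left nhdsWithin_le_nhds |>.eventually_lt_const ?_
      simpa using hε
    obtain ⟨a, h2, h3⟩ := ((eventually_of_mem (Ioo_mem_nhdsLT (zero_lt_one' ℝ)) fun a ha => ha).and h1).exists
    exact ⟨a, h2, h3⟩
  obtain ⟨r, Q, q, hr0, hr, hq, hqn, hqa, hqI⟩ := exists_isRadialWeight_shell E ha0 ha1
  refine ⟨r, Q, q, hr0, hr, hq, hqn, hqI, ?_⟩
  have hP := harmonicOnNhd_unitBallPoissonKernel he
  -- The kernel equals `1` at the origin, so it has weighted mean `1`.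
  have hPI : ∫ x, unitBallPoissonKernel e x * q x = ∫ x, q x := by
    rw [hP.integral_mul_radialWeight hr0 hr hq]
    simp [unitBallPoissonKernel, he]
  have hf' : ContinuousOn f (ball 0 1) := hf.mono ball_subset_closedBall
  have hI1 : Integrable fun x => f x * unitBallPoissonKernel e x * q x :=
    hq.integrable_mul hr (hf'.mul hP.continuousOn)
  have hI2 := hq.integrable_mul hr hP.continuousOn
  have hI3 : Integrable fun x => 1 * q x := hq.integrable_mul hr continuousOn_const
  simp only [one_mul] at hI3
  rw [show f e * ∫ x, q x = ∫ x, f e * (unitBallPoissonKernel e x * q x) by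
    rw [integral_const_mul, hPI], ← integral_sub hI1 (hI2.const_mul _), ← Real.norm_eq_abs]
  have hbound : ∫ x, (ε / 2 * (unitBallPoissonKernel e x * q x) + ε / 2 * q x)
      = ε * ∫ x, q x := by
    rw [integral_add (hI2.const_mul _) (hI3.const_mul _), integral_const_mul, integral_const_mul,
      hPI]
    ring
  rw [← hbound]
  refine norm_integral_le_of_norm_le ((hI2.const_mul _).add (hI3.const_mul _))
    (Eventually.of_forall fun x => ?_)
  by_cases hqx : q x = 0
  · simp [hqx]
  have hxa : a < ‖x‖ := not_le.1 fun h => hqx (hqa x h)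
  have hxr : ‖x‖ < r := not_le.1 fun h => hqx (hq.weight_eq_zero x h)
  have hx1 : ‖x‖ ≤ 1 := (hxr.trans hr).le
  have hPx := unitBallPoissonKernel_nonneg e hx1
  have hxb : x ∈ closedBall (0 : E) 1 := by simpa using hx1
  -- Near the pole continuity of `f` gives the first term; away from it the smallness of the kernel
  -- gives the second.
  have hle : |f x - f e| * unitBallPoissonKernel e x
      ≤ ε / 2 * unitBallPoissonKernel e x + ε / 2 := by
    rcases lt_or_ge (dist x e) δ with h | h
    · have h1 := (hfδ hxb h).le
      rw [Real.dist_eq] at h1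
      nlinarith
    · have h1 : |f x - f e| ≤ 2 * M := by
        have h2 := hM x hxb
        have h3 := hM e heb
        rw [Real.norm_eq_abs] at h2 h3
        linarith [abs_sub (f x) (f e)]
      rw [dist_eq_norm] at h
      have h2 := unitBallPoissonKernel_le ha0.le hxa.le hx1 hδ h
      have h3 : |f x - f e| * unitBallPoissonKernel e x
          ≤ 2 * M * ((1 - a ^ 2) / δ ^ Module.finrank ℝ E) := by gcongr
      nlinarith
  rw [show f x * unitBallPoissonKernel e x * q x - f e * (unitBallPoissonKernel e x * q x)
    = (f x - f e) * unitBallPoissonKernel e x * q x by ring, norm_mul, norm_mul,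
    Real.norm_eq_abs, Real.norm_of_nonneg hPx, Real.norm_of_nonneg (hqn x)]
  nlinarith [hqn x]

/-- Two-sided pointwise Harnack bounds for nonnegative harmonic functions in the unit ball. -/
theorem InnerProductSpace.HarmonicOnNhd.harnack_bounds {u : E → ℝ}
    (hu : HarmonicOnNhd u (ball 0 1)) (hu0 : ∀ x ∈ ball (0 : E) 1, 0 ≤ u x) {s : ℝ} (hs0 : 0 ≤ s)
    (hs : s < 1) {z : E} (hz : ‖z‖ ≤ s) :
    (1 - s ^ 2) / (1 + s) ^ Module.finrank ℝ E * u 0 ≤ u z ∧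
      u z ≤ 1 / (1 - s) ^ Module.finrank ℝ E * u 0 := by
  have h0 : 0 ≤ u 0 := hu0 0 (mem_ball_self one_pos)
  rcases eq_or_ne z 0 with rfl | hz0
  -- The origin determines no pole, so it is treated directly.
  · constructor
    · refine mul_le_of_le_one_left h0 (div_le_one_of_le₀ ?_ (by positivity))
      nlinarith [one_le_pow₀ (n := Module.finrank ℝ E) (by linarith : 1 ≤ 1 + s)]
    · refine le_mul_of_one_le_left h0 ?_
      rw [one_le_div (pow_pos (by linarith) _)]
      exact pow_le_one₀ (by linarith) (by linarith)
  have : Nontrivial E := ⟨z, 0, hz0⟩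
  set t := ‖z‖ with ht
  have ht0 : 0 < t := norm_pos_iff.2 hz0
  set e := t⁻¹ • z with he_def
  have he : ‖e‖ = 1 := by
    rw [he_def, norm_smul, norm_inv, norm_norm, inv_mul_cancel₀ ht0.ne']
  have hte : t • e = z := smul_inv_smul₀ ht0.ne' z
  have hmaps {x : E} (hx : x ∈ closedBall (0 : E) 1) : t • x ∈ ball (0 : E) 1 := by
    rw [mem_closedBall_zero_iff] at hx
    rw [mem_ball_zero_iff, norm_smul, norm_norm]
    nlinarith [norm_nonneg x]
  have hft : ContinuousOn (fun x => u (t • x)) (closedBall 0 1) :=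
    hu.continuousOn.comp (by fun_prop) fun x hx => hmaps hx
  have hP := harmonicOnNhd_unitBallPoissonKernel he
  have hPt : ContinuousOn (fun x => unitBallPoissonKernel e (t • x)) (ball 0 1) :=
    hP.continuousOn.comp (by fun_prop) fun x hx => hmaps (ball_subset_closedBall hx)
  have key {ε : ℝ} (hε : 0 < ε) :
      (1 - s ^ 2) / (1 + s) ^ Module.finrank ℝ E * u 0 ≤ u z + ε ∧
        u z ≤ 1 / (1 - s) ^ Module.finrank ℝ E * u 0 + ε := by
    obtain ⟨r, Q, q, hr0, hr, hq, hqn, hqI, h⟩ :=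
      exists_isRadialWeight_abs_integral_poissonKernel_sub_le he hft hε
    -- The dilation by `t` passes from `u` to the kernel, where it can be bounded uniformly.
    rw [hu.integral_dilation_swap hr0 hr hq hP ht0 (hz.trans hs.le), hte] at h
    have hmean := hu.integral_mul_radialWeight hr0 hr hq
    have hIu := hq.integrable_mul hr hu.continuousOn
    have hI : Integrable fun x => u x * unitBallPoissonKernel e (t • x) * q x :=
      hq.integrable_mul hr (hu.continuousOn.mul hPt)
    have hlow : (1 - s ^ 2) / (1 + s) ^ Module.finrank ℝ E * (u 0 * ∫ x, q x)
        ≤ ∫ x, u x * unitBallPoissonKernel e (t • x) * q x := by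
      rw [← hmean, ← integral_const_mul]
      refine integral_mono (hIu.const_mul _) hI fun x => ?_
      by_cases hx : x ∈ ball (0 : E) 1
      · have h1 := (unitBallPoissonKernel_smul_bounds he (mem_ball_zero_iff.1 hx).le ht0.le hz
          hs).1
        have h2 := mul_le_mul_of_nonneg_right h1 (mul_nonneg (hu0 x hx) (hqn x))
        simp only
        linarith
      · have hx' : q x = 0 := hq.weight_eq_zero x (by
          rw [mem_ball_zero_iff, not_lt] at hx
          linarith)
        simp [hx']
    have hup : ∫ x, u x * unitBallPoissonKernel e (t • x) * q x
        ≤ 1 / (1 - s) ^ Module.finrank ℝ E * (u 0 * ∫ x, q x) := by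
      rw [← hmean, ← integral_const_mul]
      refine integral_mono hI (hIu.const_mul _) fun x => ?_
      by_cases hx : x ∈ ball (0 : E) 1
      · have h1 := (unitBallPoissonKernel_smul_bounds he (mem_ball_zero_iff.1 hx).le ht0.le hz
          hs).2
        have h2 := mul_le_mul_of_nonneg_right h1 (mul_nonneg (hu0 x hx) (hqn x))
        simp only
        linarith
      · have hx' : q x = 0 := hq.weight_eq_zero x (by
          rw [mem_ball_zero_iff, not_lt] at hx
          linarith)
        simp [hx']
    rw [abs_le] at h
    constructor <;> refine le_of_mul_le_mul_right ?_ hqI <;> linarith [h.1, h.2]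
  exact ⟨le_of_forall_pos_le_add fun ε hε => (key hε).1,
    le_of_forall_pos_le_add fun ε hε => (key hε).2⟩

/-- Harnack's inequality for nonnegative harmonic functions in a ball, comparing two points of a
smaller concentric closed ball. -/
theorem InnerProductSpace.HarmonicOnNhd.harnack {u : E → ℝ} {y : E} {ρ : ℝ} (hρ : 0 < ρ)
    (hu : HarmonicOnNhd u (ball y ρ)) (hu0 : ∀ x ∈ ball y ρ, 0 ≤ u x) {s : ℝ} (hs0 : 0 ≤ s)
    (hs : s < 1) {z w : E} (hz : z ∈ closedBall y (s * ρ)) (hw : w ∈ closedBall y (s * ρ)) :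
    u z ≤ 1 / (1 - s ^ 2) * ((1 + s) / (1 - s)) ^ Module.finrank ℝ E * u w := by
  have hmaps : ∀ x ∈ ball (0 : E) 1, y + ρ • x ∈ ball y ρ := fun x hx => by
    rw [mem_ball_zero_iff] at hx
    rw [mem_ball, dist_eq_norm, add_sub_cancel_left, norm_smul, Real.norm_of_nonneg hρ.le]
    nlinarith
  have hnorm {z : E} (hz : z ∈ closedBall y (s * ρ)) : ‖ρ⁻¹ • (z - y)‖ ≤ s := by
    rw [mem_closedBall, dist_eq_norm] at hz
    rw [norm_smul, norm_inv, Real.norm_of_nonneg hρ.le, inv_mul_le_iff₀ hρ]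
    linarith
  have hback (z : E) : y + ρ • ρ⁻¹ • (z - y) = z := by
    rw [smul_inv_smul₀ hρ.ne', add_sub_cancel]
  have hu' := hu.comp_const_add_smul y ρ hmaps
  have h1 := (hu'.harnack_bounds (fun x hx => hu0 _ (hmaps x hx)) hs0 hs (hnorm hz)).2
  have h2 := (hu'.harnack_bounds (fun x hx => hu0 _ (hmaps x hx)) hs0 hs (hnorm hw)).1
  simp only [hback] at h1 h2
  have hs2 : 0 < 1 - s ^ 2 := by nlinarith
  have hs1 : 0 < 1 - s := by linarith
  refine h1.trans ?_
  have h3 := mul_le_mul_of_nonneg_left h2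
    (by positivity : 0 ≤ 1 / (1 - s ^ 2) * ((1 + s) / (1 - s)) ^ Module.finrank ℝ E)
  -- `C(s)` times the lower constant `(1 - s²) / (1 + s)ⁿ` is exactly the upper constant `1 / (1 -
  -- s)ⁿ`.
  refine le_trans (le_of_eq ?_) h3
  rw [div_pow]
  have h4 : (1 - s) ^ Module.finrank ℝ E ≠ 0 := by positivity
  have h5 : (1 + s) ^ Module.finrank ℝ E ≠ 0 := by positivity
  field_simp

end Harnack

theorem mainTheorem10 (n : ℕ) (hn : 2 ≤ n) (x : EuclideanSpace ℝ (Fin n)) (r : ℝ) (hr : 0 < r)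
    (u : EuclideanSpace ℝ (Fin n) → ℝ)
    (hu : InnerProductSpace.HarmonicOnNhd u (Metric.ball x r))
    (hpos : ∀ y ∈ Metric.ball x r, 0 < u y) :
    IsHarnackFunction (Metric.ball x r)
      (fun s : ℝ => 1 / (1 - s ^ 2) * ((1 + s) / (1 - s)) ^ n) u := by
  intro s hs
  have hs1 : 0 < 1 - s := by linarith [hs.2]
  have hs2 : 0 < 1 - s ^ 2 := by nlinarith [hs.1, hs.2]
  have : Nonempty (Fin n) := ⟨⟨0, by omega⟩⟩
  refine ⟨⟨isOpen_ball, ⟨⟨x, mem_ball_self hr⟩, (convex_ball x r).isPreconnected⟩, fun h => ?_⟩,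
    hu.continuousOn, fun y hy => (hpos y hy).le, hs, ?_, fun y ρ hρ hball => ?_⟩
  · exact NormedSpace.unbounded_univ ℝ (EuclideanSpace ℝ (Fin n)) (h ▸ isBounded_ball)
  · have h1 : 1 ≤ 1 / (1 - s ^ 2) := by
      rw [one_le_div hs2]
      nlinarith
    have h2 : 1 ≤ (1 + s) / (1 - s) := by
      rw [one_le_div hs1]
      linarith [hs.1]
    exact one_le_mul_of_one_le_of_one_le h1 (one_le_pow₀ h2)
  · have hsub : closedBall y (s * ρ) ⊆ ball y ρ := closedBall_subset_ball (by nlinarith [hs.2])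
    have hcont : ContinuousOn u (closedBall y (s * ρ)) :=
      hu.continuousOn.mono (hsub.trans hball)
    have hne : (closedBall y (s * ρ)).Nonempty :=
      ⟨y, mem_closedBall_self (mul_nonneg hs.1.le hρ.le)⟩
    obtain ⟨z, hz, hzmax⟩ := (isCompact_closedBall y (s * ρ)).exists_isMaxOn hne hcont
    obtain ⟨w, hw, hwmin⟩ := (isCompact_closedBall y (s * ρ)).exists_isMinOn hne hcont
    refine ⟨u z, u w, ⟨Set.mem_image_of_mem u hz, ?_⟩, ⟨Set.mem_image_of_mem u hw, ?_⟩, ?_⟩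
    · rintro _ ⟨v, hv, rfl⟩
      exact hzmax hv
    · rintro _ ⟨v, hv, rfl⟩
      exact hwmin hv
    · have h := (hu.mono hball).harnack hρ (fun v hv => (hpos v (hball hv)).le) hs.1.le hs.2 hz hw
      rwa [finrank_euclideanSpace_fin] at h
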